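/- Let $n \ge 1$, let $M$ be a linear hypersurface of $\mathbb{R}^n$, i.e. a (relatively) open subset of an affine hyperplane $\Pi \subseteq \mathbb{R}^n$, and let $\mathscr{L}$ be a continuous line bundle over $M$, given by a continuous map $\varphi : M \to \mathbb{P}^{n-1}$ into the space of lines through the origin of $\mathbb{R}^n$; that is, $$\mathscr{L} = \{(p,u) \in \mathbb{R}^n \times \mathbb{R}^n \mid p \in M,\ u \in \varphi(p)\}.$$ Let $\Delta_* : \mathbb{R}^n \times \mathbb{R}^n \to \mathbb{R}^n$, $\Delta_*(x,y) = x+y$, be the codiagonal map, so that $\Delta_*\mathscr{L} = \bigcup_{p \in M} (p + \varphi(p))$. Then $\Delta_*\mathscr{L}$ has non-empty interior in $\mathbb{R}^n$ if and only if $\mathscr{L}$ is not tangent to $M$, where $\mathscr{L}$ is called tangent to $M$ if $\varphi(p) \subseteq T_pM$ for every $p \in M$. -/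

import Mathlib

open scoped LinearAlgebra.Projectivization Topology

/-- The usual topology of the projective space of lines through the origin of a real
topological vector space `V`: the quotient topology from `V` minus the origin. -/
noncomputable instance projectiveSpaceTopology {V : Type*} [AddCommGroup V] [Module ℝ V] [TopologicalSpace V] :
    TopologicalSpace (ℙ ℝ V) :=
  TopologicalSpace.coinduced (fun v : {v : V // v ≠ 0} => Projectivization.mk ℝ v.1 v.2)
    inferInstance

/-- A (continuous, embedded) line bundle over a subset `X` of `ℝⁿ`, given by the continuous map
`X → ℙⁿ⁻¹` that sends a point of `X` to the fibre over it. -/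
structure EmbeddedLineBundle {n : ℕ} (X : Set (EuclideanSpace ℝ (Fin n))) where
  /-- The classifying map. -/
  fibre : X → ℙ ℝ (EuclideanSpace ℝ (Fin n))
  /-- The fibre depends continuously on the base point. -/
  continuous_fibre : Continuous fibre

/-- The total space `{(p, u) | p ∈ X, u ∈ φ(p)} ⊆ ℝⁿ × ℝⁿ` of the line bundle defined by `φ`. -/
def EmbeddedLineBundle.totalSpace {n : ℕ} {X : Set (EuclideanSpace ℝ (Fin n))}
    (L : EmbeddedLineBundle X) : Set (EuclideanSpace ℝ (Fin n) × EuclideanSpace ℝ (Fin n)) :=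
  {q | ∃ p : X, q.1 = p ∧ q.2 ∈ (L.fibre p).submodule}

/-- The image `Δ_* E` of a subset `E` of `ℝⁿ × ℝⁿ` under the codiagonal `(x, y) ↦ x + y`. -/
def codiagonalImage {n : ℕ} (E : Set (EuclideanSpace ℝ (Fin n) × EuclideanSpace ℝ (Fin n))) :
    Set (EuclideanSpace ℝ (Fin n)) :=
  (fun q => q.1 + q.2) '' E

/-- The tangent vectors of `M` at `p`: the velocities at `p` of the curves in `M` through `p` that
are differentiable there. If `M` is a differentiable submanifold, this is the
tangent space `T_p M`, the image of the differential of a parametrization. -/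
def tangentVectors {n : ℕ} (M : Set (EuclideanSpace ℝ (Fin n))) (p : EuclideanSpace ℝ (Fin n)) :
    Set (EuclideanSpace ℝ (Fin n)) :=
  {u | ∃ γ : ℝ → EuclideanSpace ℝ (Fin n),
    γ 0 = p ∧ (∀ᶠ t in 𝓝 0, γ t ∈ M) ∧ HasDerivAt γ u 0}

/-- The line bundle `L` over `M` is tangent to `M`: every fibre is contained in the tangent space
of `M` at the base point. -/
def EmbeddedLineBundle.IsTangent {n : ℕ} {M : Set (EuclideanSpace ℝ (Fin n))}
    (L : EmbeddedLineBundle M) : Prop :=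
  ∀ p : M, ((L.fibre p).submodule : Set (EuclideanSpace ℝ (Fin n))) ⊆ tangentVectors M p

/-- `M` is a linear hypersurface of `ℝⁿ`: a relatively open subset of an affine subspace of
dimension `n - 1`. -/
def IsLinearHypersurface {n : ℕ} (M : Set (EuclideanSpace ℝ (Fin n))) : Prop :=
  ∃ H : AffineSubspace ℝ (EuclideanSpace ℝ (Fin n)),
    (H : Set (EuclideanSpace ℝ (Fin n))).Nonempty ∧ Module.finrank ℝ H.direction + 1 = n ∧
      ∃ U : Set (EuclideanSpace ℝ (Fin n)), IsOpen U ∧ M = U ∩ H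

/-! If every fibre is tangent, each line `p + φ(p)` stays in the hyperplane, which has empty
interior. Otherwise some fibre is transverse to the hyperplane at a point `p`, and by continuity so
are the nearby ones. Scale their vectors `v d` to height `1` along the unit normal `ν`. Reaching `y`
near `p` forces the coefficient `t = ⟪ν, y - p⟫` and leaves the equation `d = π (y - p) - t • π (v
d)`, with `π` the projection along `ν`. For small `t` the right side maps a closed ball to itself;
as `v` is merely continuous, Brouwer's theorem solves it (`mem_nhds_of_forall_add_smul_mem`).

Brouwer rests on `integral_det_one_add_fderiv_sub_one`: the integral of `det (1 + Dw) - 1` vanishes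
for compactly supported `C¹` maps `w`. If `id + w` omitted `0`, following it by a shear-like map
would give another such perturbation, whose Jacobian integral differs by that of a nonzero bump `g ≥
0`, which is impossible. -/

/-! ### Determinants of perturbations of the identity. -/

section Determinant

open Polynomial in
/-- The determinant of `1 + A` is a fixed affine combination of the determinants of `1 + sᵢ A`, for
any family of sufficiently many distinct scalars `sᵢ`. -/
theorem LinearMap.det_one_add_eq_sum_lagrange {K E : Type*} [Field K] [AddCommGroup E] [Module K E]
    [FiniteDimensional K E] {s : Finset ℕ} {v : ℕ → K} (hv : Set.InjOn v s)
    (hs : Module.finrank K E < s.card) (A : E →ₗ[K] E) :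
    LinearMap.det (1 + A) =
      ∑ i ∈ s, (Lagrange.basis s v i).eval 1 * LinearMap.det (1 + v i • A) := by
  classical
  let b := Module.finBasis K E
  let N := LinearMap.toMatrix b b A
  -- `det (1 + t A)` is a polynomial in `t` of degree at most the dimension, so interpolation at
  -- more nodes than that recovers its value at `1`.
  let p : K[X] := Matrix.det ((X : K[X]) • N.map C + (1 : Matrix _ _ K).map C)
  have hp (t : K) : p.eval t = LinearMap.det (1 + t • A) := by
    rw [← LinearMap.det_toMatrix b, ← coe_evalRingHom, RingHom.map_det]
    congr 1
    ext i j
    by_cases hij : i = j <;> simp [N, hij, LinearMap.toMatrix_one] <;> ring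
  have hdeg : p.degree < s.card := by
    refine lt_of_le_of_lt degree_le_natDegree ?_
    have := natDegree_det_X_add_C_le N 1
    simp only [Fintype.card_fin] at this
    exact_mod_cast this.trans_lt hs
  have h1 := congrArg (eval 1) (Lagrange.eq_interpolate hv hdeg)
  rw [hp, one_smul, Lagrange.interpolate_apply, eval_finsetSum] at h1
  rw [h1]
  refine Finset.sum_congr rfl fun i _ => ?_
  rw [eval_mul, eval_C, hp, mul_comm]

section

variable {E : Type*} [NormedAddCommGroup E] [NormedSpace ℝ E]

theorem ContinuousLinearMap.det_one : (1 : E →L[ℝ] E).det = 1 := by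
  simp [ContinuousLinearMap.det]

theorem continuous_det_one_add_fderiv {w : E → E} (hw : ContDiff ℝ 1 w) :
    Continuous fun x => (1 + fderiv ℝ w x).det :=
  ContinuousLinearMap.continuous_det.comp
    (continuous_const.add (hw.continuous_fderiv one_ne_zero))

theorem hasCompactSupport_det_one_add_fderiv_sub_one {w : E → E} (hw : HasCompactSupport w) :
    HasCompactSupport fun x => (1 + fderiv ℝ w x).det - 1 :=
  (hw.fderiv ℝ).comp_left (g := fun A : E →L[ℝ] E => (1 + A).det - 1)
    (by simp [ContinuousLinearMap.det_one])

end

variable {E : Type*} [NormedAddCommGroup E] [NormedSpace ℝ E] [FiniteDimensional ℝ E]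

/-- Along the segment `1 + t A` the determinant starts at `1` and cannot vanish, by the Neumann
series. -/
theorem ContinuousLinearMap.det_one_add_pos_of_norm_lt_one {A : E →L[ℝ] E} (hA : ‖A‖ < 1) :
    0 < (1 + A).det := by
  by_contra! h
  have hc : ContinuousOn (fun t : ℝ => (1 + t • A).det) (Set.Icc 0 1) :=
    (ContinuousLinearMap.continuous_det.comp (by fun_prop)).continuousOn
  have h0 : (1 + (0 : ℝ) • A).det = 1 := by
    simp [ContinuousLinearMap.det]
  obtain ⟨t, ht, hdet⟩ := intermediate_value_Icc' zero_le_one hc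
    (show (0 : ℝ) ∈ Set.Icc _ _ by rw [h0, one_smul]; exact ⟨h, zero_le_one⟩)
  have hlt : ‖-(t • A)‖ < 1 := by
    rw [norm_neg, norm_smul, Real.norm_of_nonneg ht.1]
    nlinarith [norm_nonneg A, ht.1, ht.2]
  have hu := isUnit_one_sub_of_norm_lt_one hlt
  rw [sub_neg_eq_add] at hu
  have := (LinearMap.isUnit_det _ (hu.map ContinuousLinearMap.toLinearMapRingHom))
  exact this.ne_zero hdet

end Determinant

/-! ### Invariance of the Jacobian integral. -/

section DegreeIntegral

open MeasureTheory Metric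

variable {E : Type*} [NormedAddCommGroup E] [NormedSpace ℝ E] [FiniteDimensional ℝ E]
  [MeasurableSpace E] [BorelSpace E] (μ : Measure E) [μ.IsAddHaarMeasure]

/-- Here `id + w` is a bijection by the contraction principle, and it is the identity off a ball
`B`. Hence it maps `B` onto itself, and the change of variables formula, with positive Jacobian,
compares the volume of `B` with itself. -/
theorem integral_det_one_add_fderiv_sub_one_of_lipschitzWith {w : E → E} (hw : ContDiff ℝ 1 w)
    (hcs : HasCompactSupport w) {K : NNReal} (hK : K < 1) (hLip : LipschitzWith K w) :
    ∫ x, ((1 + fderiv ℝ w x).det - 1) ∂μ = 0 := by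
  obtain ⟨R, hR⟩ := hcs.isCompact.isBounded.subset_closedBall 0
  set B : Set E := closedBall 0 R
  have hzero {x : E} (hx : x ∉ B) : w x = 0 := image_eq_zero_of_notMem_tsupport fun h => hx (hR h)
  have hinj : Function.Injective fun x => x + w x := by
    intro x y hxy
    have h1 : x - y = w y - w x := by
      rw [sub_eq_sub_iff_add_eq_add]; simpa [add_comm] using hxy
    have h2 : ‖x - y‖ ≤ K * ‖x - y‖ := by
      conv_lhs => rw [h1, ← dist_eq_norm, dist_comm]
      simpa [dist_eq_norm] using hLip.dist_le_mul x y
    have h3 : (K : ℝ) < 1 := hK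
    have : ‖x - y‖ ≤ 0 := by nlinarith [norm_nonneg (x - y)]
    exact sub_eq_zero.1 (norm_le_zero_iff.1 this)
  have hsurj (y : E) : ∃ x, x + w x = y := by
    have hc : ContractingWith K fun z => y - w z :=
      ⟨hK, by simpa using (LipschitzWith.const y).sub hLip⟩
    refine ⟨hc.fixedPoint, ?_⟩
    have h := hc.fixedPoint_isFixedPt
    simp only [Function.IsFixedPt] at h
    nth_rw 1 [← h]
    simp
  have himage : (fun x => x + w x) '' B = B := by
    ext y
    constructor
    · rintro ⟨x, hx, rfl⟩
      by_contra hy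
      have := hinj (a₁ := x + w x) (a₂ := x) (by simp [hzero hy])
      exact hy (by simpa only [this] using hx)
    · intro hy
      obtain ⟨x, rfl⟩ := hsurj y
      refine ⟨x, ?_, rfl⟩
      by_contra hx
      rw [hzero hx, add_zero] at hy
      exact hx hy
  have hder (x : E) : HasFDerivAt (fun x => x + w x) (1 + fderiv ℝ w x) x :=
    (hasFDerivAt_id x).add (hw.differentiable one_ne_zero x).hasFDerivAt
  have hpos (x : E) : 0 < (1 + fderiv ℝ w x).det :=
    ContinuousLinearMap.det_one_add_pos_of_norm_lt_one
      ((norm_fderiv_le_of_lipschitz ℝ hLip).trans_lt hK)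
  have hvol := integral_image_eq_integral_abs_det_fderiv_smul μ isClosed_closedBall.measurableSet
    (fun x (_ : x ∈ B) => (hder x).hasFDerivWithinAt) hinj.injOn fun _ => (1 : ℝ)
  rw [himage] at hvol
  simp only [abs_of_pos (hpos _), smul_eq_mul, mul_one] at hvol
  have hcont := continuous_det_one_add_fderiv hw
  have hB : IsCompact B := isCompact_closedBall 0 R
  rw [← setIntegral_eq_integral_of_forall_compl_eq_zero (s := B), integral_sub, ← hvol, sub_self]
  · exact hcont.continuousOn.integrableOn_compact hB
  · exact continuous_const.continuousOn.integrableOn_compact hB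
  · intro x hx
    have : fderiv ℝ w x = 0 :=
      image_eq_zero_of_notMem_tsupport fun h => hx (hR (tsupport_fderiv_subset ℝ h))
    simp [this, ContinuousLinearMap.det_one]

/-- The integral of the Jacobian determinant of a compactly supported perturbation of the identity
is that of the identity. -/
theorem integral_det_one_add_fderiv_sub_one {w : E → E} (hw : ContDiff ℝ 1 w)
    (hcs : HasCompactSupport w) : ∫ x, ((1 + fderiv ℝ w x).det - 1) ∂μ = 0 := by
  obtain ⟨K, hK⟩ := hw.lipschitzWith_of_hasCompactSupport hcs one_ne_zero
  let m := Module.finrank ℝ E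
  -- Chosen so that `i * ε * K < 1` for all `i ≤ m`: each scaled map `v i • w` falls under the
  -- contraction case, and the `m + 1` nodes suffice for degree `m`.
  let ε : NNReal := ((m + 1) * (K + 1))⁻¹
  have hε : ε ≠ 0 := by positivity
  let v : ℕ → ℝ := fun i => i * ε
  have hv : Set.InjOn v (Finset.range (m + 1)) := by
    intro i _ j _ hij
    have : (ε : ℝ) ≠ 0 := by exact_mod_cast hε
    simpa [v, this] using hij
  have hne : (Finset.range (m + 1)).Nonempty := ⟨0, by simp⟩
  have hsmul (i : ℕ) (x : E) : fderiv ℝ (v i • w) x = v i • fderiv ℝ w x :=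
    fderiv_const_smul (hw.differentiable one_ne_zero x) (v i)
  have hsum1 : ∑ i ∈ Finset.range (m + 1),
      (Lagrange.basis (Finset.range (m + 1)) v i).eval 1 = 1 := by
    rw [← Polynomial.eval_finsetSum, Lagrange.sum_basis hv hne, Polynomial.eval_one]
  have hpt (x : E) : (1 + fderiv ℝ w x).det - 1 = ∑ i ∈ Finset.range (m + 1),
      (Lagrange.basis (Finset.range (m + 1)) v i).eval 1 *
        ((1 + fderiv ℝ (v i • w) x).det - 1) := by
    simp only [mul_sub, mul_one, Finset.sum_sub_distrib, hsum1, hsmul]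
    congr 1
    exact LinearMap.det_one_add_eq_sum_lagrange hv (by simp [m]) (fderiv ℝ w x : E →ₗ[ℝ] E)
  have hwi (i : ℕ) : ContDiff ℝ 1 (v i • w) := contDiff_const.smul hw
  have hci (i : ℕ) : HasCompactSupport (v i • w) := hcs.smul_left (f := fun _ => v i)
  simp_rw [hpt]
  rw [integral_finsetSum]
  · refine Finset.sum_eq_zero fun i hi => ?_
    rw [integral_const_mul,
      integral_det_one_add_fderiv_sub_one_of_lipschitzWith μ (hwi i) (hci i)
        (K := (i * ε) * K) ?_ ?_, mul_zero]
    · have : (i : NNReal) ≤ m := by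
        exact_mod_cast Nat.lt_succ_iff.1 (Finset.mem_range.1 hi)
      calc (i * ε : NNReal) * K ≤ m * ε * K := by gcongr
        _ = (m * K) / ((m + 1) * (K + 1)) := by simp only [ε]; ring
        _ < 1 := by
          rw [div_lt_one (by positivity), ← NNReal.coe_lt_coe]
          push_cast
          have : (0 : ℝ) ≤ m := by positivity
          nlinarith [K.coe_nonneg]
    · refine LipschitzWith.of_dist_le_mul fun x y => ?_
      have h := hK.dist_le_mul x y
      simp only [Pi.smul_apply, dist_smul₀, v, Real.norm_eq_abs]
      rw [abs_of_nonneg (by positivity)]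
      push_cast
      rw [mul_assoc _ (K : ℝ)]
      exact mul_le_mul_of_nonneg_left h (by positivity)
  · intro i _
    exact (((continuous_det_one_add_fderiv (hwi i)).sub continuous_const).integrable_of_hasCompactSupport
      (hasCompactSupport_det_one_add_fderiv_sub_one (hci i))).const_mul _

end DegreeIntegral

/-! ### Zeros of smooth perturbations of the identity. -/

section SmoothPerturbation

open MeasureTheory Metric

variable {E : Type*} [NormedAddCommGroup E] [InnerProductSpace ℝ E] [FiniteDimensional ℝ E]

/-- The difference of a bump function and its translate along a unit vector `e` is the derivative in
direction `e` of a compactly supported function. -/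
theorem exists_potential_bump_sub_translate {e : E} (he : ‖e‖ = 1) {δ T : ℝ} (hδ : 0 < δ)
    (hT : 0 ≤ T) : ∃ κ g : E → ℝ, ContDiff ℝ 1 κ ∧ HasCompactSupport κ ∧ Continuous g ∧
      (∀ y, 0 ≤ g y) ∧ (∃ y, g y ≠ 0) ∧ (∀ y, δ ≤ ‖y‖ → g y = 0) ∧
      ∀ y, fderiv ℝ κ y e = g y - g (y - T • e) := by
  -- A smooth step rising from `0` to `1` on `[0, δ / 2]`. The difference of `A` and its translate
  -- by `T` vanishes far out on both sides; a bump `b` in the directions orthogonal to `e` makes the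
  -- support compact.
  let A : ℝ → ℝ := fun t => Real.smoothTransition (2 / δ * t)
  have hA : ContDiff ℝ 1 A := Real.smoothTransition.contDiff.comp (contDiff_const.mul contDiff_id)
  have hA0 {t : ℝ} (ht : t ≤ 0) : A t = 0 :=
    Real.smoothTransition.zero_of_nonpos (mul_nonpos_of_nonneg_of_nonpos (by positivity) ht)
  have hA1 {t : ℝ} (ht : δ / 2 ≤ t) : A t = 1 := by
    refine Real.smoothTransition.one_of_one_le ?_
    rw [div_mul_eq_mul_div, le_div_iff₀ hδ]
    linarith
  have hmono : Monotone A := fun s t hst =>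
    Real.smoothTransition.monotone (mul_le_mul_of_nonneg_left hst (by positivity))
  have hdA0 {t : ℝ} (ht : t < 0) : deriv A t = 0 := by
    have : A =ᶠ[𝓝 t] fun _ => 0 := by
      filter_upwards [Iio_mem_nhds ht] with s hs using hA0 (le_of_lt hs)
    simpa using this.deriv_eq
  have hdA1 {t : ℝ} (ht : δ / 2 < t) : deriv A t = 0 := by
    have : A =ᶠ[𝓝 t] fun _ => 1 := by
      filter_upwards [Ioi_mem_nhds ht] with s hs using hA1 (le_of_lt hs)
    simpa using this.deriv_eq
  obtain ⟨t₀, -, ht₀⟩ := exists_deriv_eq_slope A (half_pos hδ) hA.continuous.continuousOn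
    (hA.differentiable one_ne_zero).differentiableOn
  let b : ContDiffBump (0 : E) := ⟨δ / 4, δ / 2, by positivity, by linarith⟩
  let c : E → ℝ := fun y => inner ℝ e y
  let P : E → E := fun y => y - c y • e
  have hee : inner ℝ e e = (1 : ℝ) := by rw [real_inner_self_eq_norm_sq, he, one_pow]
  have hc : ContDiff ℝ 1 c := contDiff_const.inner ℝ contDiff_id
  have hP : ContDiff ℝ 1 P := contDiff_id.sub (hc.smul contDiff_const)
  have hb0 {y : E} (hy : δ / 2 ≤ ‖P y‖) : b (P y) = 0 :=
    b.zero_of_le_dist (by simpa [dist_eq_norm] using hy)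
  have hcadd (y : E) (s : ℝ) : c (y + s • e) = c y + s := by
    simp only [c, inner_add_right, inner_smul_right, hee, mul_one]
  have hPadd (y : E) (s : ℝ) : P (y + s • e) = P y := by
    simp only [P, hcadd, add_smul]; abel
  have hnorm (y : E) : ‖y‖ ≤ ‖P y‖ + |c y| := by
    calc ‖y‖ = ‖P y + c y • e‖ := by simp [P]
      _ ≤ _ := (norm_add_le _ _).trans (by simp [norm_smul, he])
  have hκ : ContDiff ℝ 1 fun y => (A (c y) - A (c y - T)) * b (P y) :=
    ((hA.comp hc).sub (hA.comp (hc.sub contDiff_const))).mul (b.contDiff.comp hP)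
  refine ⟨fun y => (A (c y) - A (c y - T)) * b (P y), fun y => deriv A (c y) * b (P y), hκ,
    ?_, ?_, ?_, ?_, ?_, ?_⟩
  · refine HasCompactSupport.intro (isCompact_closedBall 0 (T + δ)) fun y hy => ?_
    rw [mem_closedBall_zero_iff, not_le] at hy
    rcases le_or_gt (δ / 2) ‖P y‖ with h | h
    · simp [hb0 h]
    have h1 : T + δ / 2 < |c y| := by linarith [hnorm y]
    rcases lt_abs.1 h1 with h2 | h2
    · simp [hA1 (show δ / 2 ≤ c y by linarith), hA1 (show δ / 2 ≤ c y - T by linarith)]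
    · simp [hA0 (show c y ≤ 0 by linarith), hA0 (show c y - T ≤ 0 by linarith)]
  · exact ((hA.continuous_deriv le_rfl).comp hc.continuous).mul (b.continuous.comp hP.continuous)
  · exact fun y => mul_nonneg (hmono.deriv_nonneg) b.nonneg
  · refine ⟨t₀ • e, ?_⟩
    have h1 : c (t₀ • e) = t₀ := by simp only [c, inner_smul_right, hee, mul_one]
    have h2 : P (t₀ • e) = 0 := by simp [P, h1]
    have h3 : b 0 = 1 := b.one_of_mem_closedBall (mem_closedBall_self b.rIn_pos.le)
    simp only [h1, h2, h3, ht₀, hA1 le_rfl, hA0 le_rfl]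
    simp [hδ.ne']
  · intro y hy
    rcases le_or_gt (δ / 2) ‖P y‖ with h | h
    · simp [hb0 h]
    have h1 : δ / 2 < |c y| := by linarith [hnorm y]
    rcases lt_abs.1 h1 with h2 | h2
    · simp [hdA1 h2]
    · simp [hdA0 (show c y < 0 by linarith)]
  · intro y
    have h1 := ((hκ.differentiable one_ne_zero y).hasFDerivAt).hasLineDerivAt e
    have hd (s : ℝ) : HasDerivAt A (deriv A s) s :=
      (hA.differentiable one_ne_zero s).hasDerivAt
    have h2 : HasDerivAt (fun s => (A (c y + s) - A (c y + s - T)) * b (P y))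
        ((deriv A (c y) - deriv A (c y - T)) * b (P y)) 0 := by
      have h3 : HasDerivAt (fun s => A (c y + s)) (deriv A (c y)) 0 :=
        HasDerivAt.comp_const_add _ _ (by simpa using hd (c y))
      have h4 : HasDerivAt (fun s => A (c y + s - T)) (deriv A (c y - T)) 0 := by
        have : HasDerivAt (fun s => A (c y - T + s)) (deriv A (c y - T)) 0 :=
          HasDerivAt.comp_const_add _ _ (by simpa using hd (c y - T))
        simpa only [add_sub_right_comm] using this
      exact (h3.sub h4).mul_const _
    have h5 := h1.unique (by simpa only [HasLineDerivAt, hcadd, hPadd] using h2)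
    have h6 : y - T • e = y + (-T) • e := by simp [sub_eq_add_neg]
    simp only [h5, h6, hcadd, hPadd, ← sub_eq_add_neg]
    ring

theorem ContinuousLinearMap.det_one_add_smulRight {E : Type*} [NormedAddCommGroup E]
    [NormedSpace ℝ E] [FiniteDimensional ℝ E] (φ : E →L[ℝ] ℝ) (e : E) :
    (1 + φ.smulRight e).det = 1 + φ e := by
  rw [ContinuousLinearMap.det]
  exact LinearMap.transvection.det (φ : E →ₗ[ℝ] ℝ) e

/-- Since `w` is bounded, `‖x + w x‖` is coercive. Its minimum bounds the image away from `0` when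
there is no zero. -/
theorem exists_forall_norm_add_le_of_hasCompactSupport {E : Type*} [NormedAddCommGroup E]
    [ProperSpace E] {w : E → E} (hw : Continuous w) (hcs : HasCompactSupport w) :
    ∃ x₀, ∀ x, ‖x₀ + w x₀‖ ≤ ‖x + w x‖ := by
  obtain ⟨C, hC⟩ := hw.bounded_above_of_compact_support hcs
  refine Continuous.exists_forall_le (f := fun x => ‖x + w x‖) (continuous_id.add hw).norm ?_
  refine Filter.tendsto_atTop_mono (f := fun x => ‖x‖ - C) (fun x => ?_)
    (Filter.tendsto_atTop_add_const_right _ _ tendsto_norm_cocompact_atTop)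
  have := norm_sub_norm_le x (-w x)
  rw [norm_neg, sub_neg_eq_add] at this
  linarith [hC x]

/-- A compactly supported `C¹` perturbation of the identity has a zero. -/
theorem ContDiff.exists_add_eq_zero [Nontrivial E] {w : E → E} (hw : ContDiff ℝ 1 w)
    (hcs : HasCompactSupport w) : ∃ x, x + w x = 0 := by
  by_contra! hne
  let _ : MeasurableSpace E := borel E
  have _ : BorelSpace E := ⟨rfl⟩
  let μ : Measure E := Measure.addHaar
  obtain ⟨e, he⟩ := exists_norm_eq E zero_le_one
  obtain ⟨R, hR⟩ := hcs.isCompact.isBounded.subset_closedBall 0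
  obtain ⟨C, hC⟩ := hw.continuous.bounded_above_of_compact_support hcs
  obtain ⟨δ, hδ, hδf⟩ : ∃ δ > 0, ∀ x, δ ≤ ‖x + w x‖ := by
    obtain ⟨x₀, hx₀⟩ := exists_forall_norm_add_le_of_hasCompactSupport hw.continuous hcs
    exact ⟨_, norm_pos_iff.2 (hne x₀), hx₀⟩
  -- Far enough that the translated bump vanishes on the support of `w` and on its image under `id +
  -- w`.
  let T : ℝ := |R| + C + δ
  have hC0 : 0 ≤ C := (norm_nonneg _).trans (hC 0)
  obtain ⟨κ, g, hκ, hκc, hg, hg0, hg1, hgδ, hκe⟩ :=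
    exists_potential_bump_sub_translate he hδ (show 0 ≤ T by positivity)
  have hTe : ‖T • e‖ = T := by rw [norm_smul, he, mul_one, Real.norm_of_nonneg (by positivity)]
  have hgT {y : E} (hy : ‖y‖ ≤ |R| + C) : g (y - T • e) = 0 := by
    refine hgδ _ ?_
    have := norm_sub_norm_le (T • e) y
    rw [norm_sub_rev, hTe] at this
    simp only [T] at this ⊢
    linarith
  -- `id + w'` is `id + w` followed by `y ↦ y + κ y • e`, whose Jacobian is `1 + g y - g (y - T •
  -- e)`.
  let w' : E → E := fun x => w x + κ (x + w x) • e
  have hf : ContDiff ℝ 1 fun x => x + w x := contDiff_id.add hw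
  have hw' : ContDiff ℝ 1 w' := hw.add ((hκ.comp hf).smul contDiff_const)
  have hcs' : HasCompactSupport w' := by
    refine HasCompactSupport.intro (hcs.isCompact.union hκc.isCompact) fun x hx => ?_
    rw [Set.mem_union, not_or] at hx
    simp [w', image_eq_zero_of_notMem_tsupport hx.1, image_eq_zero_of_notMem_tsupport hx.2]
  have hdet (x : E) : (1 + fderiv ℝ w' x).det =
      (1 - g (x + w x - T • e)) * (1 + fderiv ℝ w x).det := by
    have h1 : HasFDerivAt (fun x => x + w x) (1 + fderiv ℝ w x) x :=
      (hasFDerivAt_id x).add (hw.differentiable one_ne_zero x).hasFDerivAt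
    have h2 : HasFDerivAt w' (fderiv ℝ w x +
        ((fderiv ℝ κ (x + w x)).comp (1 + fderiv ℝ w x)).smulRight e) x :=
      (hw.differentiable one_ne_zero x).hasFDerivAt.add
        (((hκ.differentiable one_ne_zero _).hasFDerivAt.comp x h1).smul_const e)
    have h3 : 1 + fderiv ℝ w' x =
        (1 + (fderiv ℝ κ (x + w x)).smulRight e) * (1 + fderiv ℝ w x) := by
      rw [h2.fderiv]
      ext v
      simp [add_assoc]
    have h4 : (1 + fderiv ℝ w' x).det =
        (1 + (fderiv ℝ κ (x + w x)).smulRight e).det * (1 + fderiv ℝ w x).det := by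
      rw [h3]; exact LinearMap.det_comp _ _
    rw [h4, ContinuousLinearMap.det_one_add_smulRight, hκe, hgδ _ (hδf x), zero_sub,
      ← sub_eq_add_neg]
  have hpt (x : E) : g (x - T • e) =
      ((1 + fderiv ℝ w x).det - 1) - ((1 + fderiv ℝ w' x).det - 1) := by
    -- On the support of `w` both sides vanish by the choice of `T`; off it, `id + w` is the
    -- identity with Jacobian `1`.
    have h1 : g (x + w x - T • e) * (1 + fderiv ℝ w x).det = g (x - T • e) := by
      by_cases hx : x ∈ tsupport w
      · have hxR : ‖x‖ ≤ |R| := (mem_closedBall_zero_iff.1 (hR hx)).trans (le_abs_self R)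
        rw [hgT ((norm_add_le _ _).trans (add_le_add hxR (hC x))), hgT (hxR.trans (by linarith)),
          zero_mul]
      · have h2 : fderiv ℝ w x = 0 :=
          image_eq_zero_of_notMem_tsupport fun h => hx (tsupport_fderiv_subset ℝ h)
        simp [image_eq_zero_of_notMem_tsupport hx, h2, ContinuousLinearMap.det_one]
    rw [hdet, ← h1]
    ring
  have hint {u : E → E} (hu : ContDiff ℝ 1 u) (hcu : HasCompactSupport u) :
      Integrable (fun x => (1 + fderiv ℝ u x).det - 1) μ :=
    ((continuous_det_one_add_fderiv hu).sub continuous_const).integrable_of_hasCompactSupport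
      (hasCompactSupport_det_one_add_fderiv_sub_one hcu)
  have hzero : ∫ x, g (x - T • e) ∂μ = 0 := by
    simp_rw [hpt]
    rw [integral_sub (hint hw hcs) (hint hw' hcs'),
      integral_det_one_add_fderiv_sub_one μ hw hcs,
      integral_det_one_add_fderiv_sub_one μ hw' hcs', sub_zero]
  rw [integral_sub_right_eq_self g (T • e)] at hzero
  have hgc : HasCompactSupport g :=
    HasCompactSupport.intro (isCompact_closedBall 0 δ) fun y hy =>
      hgδ y (le_of_not_ge fun h => hy (mem_closedBall_zero_iff.2 h))
  obtain ⟨y, hy⟩ := hg1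
  exact (hg.integral_pos_of_hasCompactSupport_nonneg_nonzero (μ := μ) hgc hg0 hy).ne' hzero

end SmoothPerturbation

/-! ### Brouwer's fixed point theorem. -/

section Brouwer

open Metric

variable {E : Type*} [NormedAddCommGroup E] [InnerProductSpace ℝ E] [FiniteDimensional ℝ E]

/-- A compactly supported continuous perturbation of the identity has a zero. -/
theorem Continuous.exists_add_eq_zero {w : E → E} (hw : Continuous w)
    (hcs : HasCompactSupport w) : ∃ x, x + w x = 0 := by
  rcases subsingleton_or_nontrivial E with hE | hE
  · exact ⟨0, Subsingleton.elim _ _⟩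
  obtain ⟨x₀, hx₀⟩ := exists_forall_norm_add_le_of_hasCompactSupport hw hcs
  refine ⟨x₀, ?_⟩
  by_contra hne
  -- The error is below the minimum of `‖x + w x‖`, so a zero of `id + u` would undercut that
  -- minimum.
  obtain ⟨u, hu, hdist, hsupp⟩ := hw.exists_contDiff_approx 1 (ε := fun _ => ‖x₀ + w x₀‖)
    continuous_const fun _ => norm_pos_iff.2 hne
  obtain ⟨x, hx⟩ := hu.exists_add_eq_zero (hcs.mono hsupp)
  have h1 : x + w x = w x - u x := by
    rw [add_comm, sub_eq_add_neg, ← eq_neg_of_add_eq_zero_left hx]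
  have h2 := hdist x
  rw [dist_comm, dist_eq_norm, ← h1] at h2
  exact (hx₀ x).not_gt h2

/-- **Brouwer's fixed point theorem** for closed balls of Euclidean spaces. -/
theorem exists_fixedPoint_of_mapsTo_closedBall {f : E → E} {r : ℝ} (hr : 0 < r)
    (hf : ContinuousOn f (closedBall 0 r)) (hmaps : Set.MapsTo f (closedBall 0 r) (closedBall 0 r)) :
    ∃ x ∈ closedBall (0 : E) r, f x = x := by
  let ρ : E → E := fun x => (r / max r ‖x‖) • x
  have hmax (x : E) : 0 < max r ‖x‖ := lt_max_of_lt_left hr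
  have hρc : Continuous ρ :=
    (continuous_const.div (continuous_const.max continuous_norm) fun x => (hmax x).ne').smul
      continuous_id
  have hρ (x : E) : ρ x ∈ closedBall 0 r := by
    rw [mem_closedBall_zero_iff, norm_smul, Real.norm_of_nonneg (div_nonneg hr.le (hmax x).le),
      div_mul_eq_mul_div, div_le_iff₀ (hmax x)]
    exact mul_le_mul_of_nonneg_left (le_max_right _ _) hr.le
  -- A cutoff equal to `1` on the ball of radius `r` and `0` beyond `2 * r`. A solution of `x = χ x
  -- • f (ρ x)` has norm at most `r`, where both `χ` and the retraction `ρ` are inactive.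
  let χ : E → ℝ := fun x => max 0 (min 1 (2 - ‖x‖ / r))
  have hχc : Continuous χ := by fun_prop
  have hχ0 (x : E) : 0 ≤ χ x := le_max_left _ _
  have hχ1 (x : E) : χ x ≤ 1 := max_le zero_le_one (min_le_left _ _)
  have hcont : Continuous fun x => -(χ x • f (ρ x)) :=
    (hχc.smul (hf.comp_continuous hρc hρ)).neg
  obtain ⟨x, hx⟩ := hcont.exists_add_eq_zero (by
    refine HasCompactSupport.intro (isCompact_closedBall 0 (2 * r)) fun x hx => ?_
    rw [mem_closedBall_zero_iff, not_le, ← lt_div_iff₀ hr] at hx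
    have : χ x = 0 := max_eq_left ((min_le_right _ _).trans (by linarith))
    simp [this])
  have hxf : x = χ x • f (ρ x) := by rwa [add_neg_eq_zero] at hx
  have hxr : ‖x‖ ≤ r := by
    rw [hxf, norm_smul, Real.norm_of_nonneg (hχ0 x)]
    have := mem_closedBall_zero_iff.1 (hmaps (hρ x))
    nlinarith [hχ0 x, hχ1 x, norm_nonneg (f (ρ x))]
  have h1 : χ x = 1 := by
    have : ‖x‖ / r ≤ 1 := (div_le_one hr).2 hxr
    simp only [χ]
    rw [min_eq_left (by linarith), max_eq_right zero_le_one]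
  have h2 : ρ x = x := by simp [ρ, max_eq_left hxr, hr.ne']
  rw [h1, h2, one_smul] at hxf
  exact ⟨x, mem_closedBall_zero_iff.2 hxr, hxf.symm⟩

end Brouwer

/-! ### Line bundles over a hyperplane and the sets they sweep out. -/

section LineBundles

open Metric Submodule

variable {V : Type*} [NormedAddCommGroup V] [InnerProductSpace ℝ V]

/-- The orthogonal projection of a fixed vector to a line depends continuously on the line. -/
theorem continuous_starProjection_submodule (x : V) :
    Continuous fun l : ℙ ℝ V => l.submodule.starProjection x := by
  refine continuous_coinduced_dom.2 ?_
  have h : ((fun l : ℙ ℝ V => l.submodule.starProjection x) ∘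
      fun v : {v : V // v ≠ 0} => Projectivization.mk ℝ v.1 v.2) =
      fun v => (inner ℝ v.1 x / ‖v.1‖ ^ 2) • v.1 := by
    funext v
    have := starProjection_singleton ℝ (v := v.1) x
    simp only [Function.comp_apply, Projectivization.submodule_mk]
    simpa using this
  rw [h]
  exact ((continuous_subtype_val.inner continuous_const).div
    (continuous_subtype_val.norm.pow 2) fun v => pow_ne_zero 2 (norm_ne_zero_iff.2 v.2)).smul
    continuous_subtype_val

theorem orthogonalProjectionOnto_add_inner_smul {ν : V} (hν : ‖ν‖ = 1) (x : V) :
    ((ℝ ∙ ν)ᗮ.orthogonalProjectionOnto x : V) + (inner ℝ ν x : ℝ) • ν = x := by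
  have h1 := starProjection_add_starProjection_orthogonal (K := ℝ ∙ ν) x
  rw [starProjection_unit_singleton ℝ hν] at h1
  rw [add_comm]
  exact h1

variable [FiniteDimensional ℝ V]

theorem exists_unit_normal_of_finrank_add_one {D : Submodule ℝ V}
    (hD : Module.finrank ℝ D + 1 = Module.finrank ℝ V) : ∃ ν : V, ‖ν‖ = 1 ∧ D = (ℝ ∙ ν)ᗮ := by
  have h1 : Module.finrank ℝ Dᗮ = 1 := by
    have := D.finrank_add_finrank_orthogonal
    omega
  have : Nontrivial Dᗮ := Module.nontrivial_of_finrank_pos (R := ℝ) (by omega)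
  obtain ⟨ν, hν⟩ := exists_norm_eq Dᗮ zero_le_one
  have hν' : ‖(ν : V)‖ = 1 := hν
  refine ⟨ν, hν', ?_⟩
  have h2 : (ℝ ∙ (ν : V)) = Dᗮ := by
    refine eq_of_le_of_finrank_eq ((span_singleton_le_iff_mem _ _).2 ν.2) ?_
    rw [h1, finrank_span_singleton (norm_ne_zero_iff.1 (by simp [hν']))]
  rw [h2, orthogonal_orthogonal]

/-- A continuous family of lines transverse to a hyperplane sweeps out a neighbourhood. -/
theorem mem_nhds_of_forall_add_smul_mem {ν : V} (hν : ‖ν‖ = 1) {p : V} {r : ℝ} (hr : 0 < r)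
    {v : (ℝ ∙ ν)ᗮ → V} (hv : ContinuousOn v (closedBall 0 r))
    (hvν : ∀ d ∈ closedBall 0 r, inner ℝ ν (v d) = (1 : ℝ)) {S : Set V}
    (hS : ∀ d ∈ closedBall 0 r, ∀ t : ℝ, p + d + t • v d ∈ S) : S ∈ 𝓝 p := by
  obtain ⟨C, hC⟩ := (isCompact_closedBall (0 : (ℝ ∙ ν)ᗮ) r).exists_bound_of_continuousOn hv
  let π := (ℝ ∙ ν)ᗮ.orthogonalProjectionOnto
  have hlt : ∀ᶠ y in 𝓝 p, ‖π (y - p)‖ + |inner ℝ ν (y - p)| * C < r := by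
    have hc : Continuous fun y => ‖π (y - p)‖ + |inner ℝ ν (y - p)| * C := by fun_prop
    exact hc.continuousAt.eventually_lt continuousAt_const (by simpa using hr)
  filter_upwards [hlt] with y hy
  let t : ℝ := inner ℝ ν (y - p)
  -- The fixed point equation is the component of `p + d + t • v d = y` orthogonal to `ν`; the
  -- component along `ν` holds by the choice of `t`.
  obtain ⟨d, hd, hfix⟩ := exists_fixedPoint_of_mapsTo_closedBall
    (f := fun d => π (y - p) - t • π (v d)) hr
    (continuousOn_const.sub ((π.continuous.comp_continuousOn hv).const_smul t)) (by
      intro d hd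
      rw [mem_closedBall_zero_iff]
      have h1 : ‖π (v d)‖ ≤ C := ((ℝ ∙ ν)ᗮ.norm_orthogonalProjectionOnto_apply_le _).trans (hC d hd)
      have h2 : ‖t • π (v d)‖ ≤ |t| * C := by
        rw [norm_smul, Real.norm_eq_abs]
        exact mul_le_mul_of_nonneg_left h1 (abs_nonneg t)
      linarith [norm_sub_le (π (y - p)) (t • π (v d))])
  have h1 : (π (v d) : V) + ν = v d := by
    have := orthogonalProjectionOnto_add_inner_smul hν (v d)
    rwa [hvν d hd, one_smul] at this
  have h2 : (π (y - p) : V) + t • ν = y - p := orthogonalProjectionOnto_add_inner_smul hν (y - p)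
  have h3 : (d : V) = π (y - p) - t • (π (v d) : V) := by
    conv_lhs => rw [← hfix]
    rfl
  have h4 : p + d + t • v d = y := by
    rw [← h1, h3, smul_add]
    calc _ = p + ((π (y - p) : V) + t • ν) := by abel
      _ = y := by rw [h2]; abel
  exact h4 ▸ hS d hd t

variable {n : ℕ}

/-- The tangent space of a relatively open subset of an affine subspace is its direction. -/
theorem tangentVectors_inter_affineSubspace {U : Set (EuclideanSpace ℝ (Fin n))} (hU : IsOpen U)
    (H : AffineSubspace ℝ (EuclideanSpace ℝ (Fin n))) {p : EuclideanSpace ℝ (Fin n)}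
    (hp : p ∈ U ∩ H) : tangentVectors (U ∩ H) p = H.direction := by
  ext u
  constructor
  · rintro ⟨γ, hγ0, hγ, hder⟩
    -- Difference quotients of a curve in `H` lie in the direction, which is closed.
    refine H.direction.closed_of_finiteDimensional.mem_of_tendsto
      hder.tendsto_slope ((hγ.filter_mono nhdsWithin_le_nhds).mono fun t ht => ?_)
    rw [slope_def_module, hγ0]
    exact H.direction.smul_mem _ (H.vsub_mem_direction ht.2 hp.2)
  · intro hu
    refine ⟨fun t => p + t • u, by simp, ?_, ?_⟩
    · have hc : Continuous fun t : ℝ => p + t • u := by fun_prop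
      filter_upwards [hc.continuousAt.preimage_mem_nhds (hU.mem_nhds (by simpa using hp.1))]
        with t ht
      refine ⟨ht, ?_⟩
      have := H.vadd_mem_of_mem_direction (H.direction.smul_mem t hu) hp.2
      rwa [vadd_eq_add, add_comm] at this
    · simpa using ((hasDerivAt_id (0 : ℝ)).smul_const u).const_add p

theorem interior_codiagonalImage_eq_empty_of_isTangent {U : Set (EuclideanSpace ℝ (Fin n))}
    (hU : IsOpen U) {H : AffineSubspace ℝ (EuclideanSpace ℝ (Fin n))} (hH : H ≠ ⊤)
    {L : EmbeddedLineBundle (U ∩ (H : Set (EuclideanSpace ℝ (Fin n))))} (hL : L.IsTangent) :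
    interior (codiagonalImage L.totalSpace) = ∅ := by
  by_contra! hne
  have hsub : codiagonalImage L.totalSpace ⊆ H := by
    rintro _ ⟨⟨x, u⟩, ⟨p, rfl, hu⟩, rfl⟩
    have h1 := hL p hu
    rw [tangentVectors_inter_affineSubspace hU H p.2] at h1
    have := H.vadd_mem_of_mem_direction h1 p.2.2
    rwa [vadd_eq_add, add_comm] at this
  have h1 := isOpen_interior.affineSpan_eq_top hne
  refine hH (top_unique (h1 ▸ affineSpan_le.2 (interior_subset.trans hsub)))

theorem interior_codiagonalImage_nonempty_of_not_isTangent {U : Set (EuclideanSpace ℝ (Fin n))}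
    (hU : IsOpen U) {H : AffineSubspace ℝ (EuclideanSpace ℝ (Fin n))}
    (hH : Module.finrank ℝ H.direction + 1 = n)
    {L : EmbeddedLineBundle (U ∩ (H : Set (EuclideanSpace ℝ (Fin n))))} (hL : ¬ L.IsTangent) :
    (interior (codiagonalImage L.totalSpace)).Nonempty := by
  obtain ⟨ν, hν, hdir⟩ := exists_unit_normal_of_finrank_add_one (D := H.direction)
    (by rw [hH, finrank_euclideanSpace_fin])
  simp only [EmbeddedLineBundle.IsTangent, not_forall] at hL
  obtain ⟨p, hp⟩ := hL
  rw [tangentVectors_inter_affineSubspace hU H p.2, Set.not_subset] at hp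
  obtain ⟨u, hu, hut⟩ := hp
  -- Projecting the normal onto each fibre gives a continuous section without local trivializations.
  -- As `⟪ν, s q⟫ = ‖s q‖ ^ 2`, it is nonzero exactly where the fibre is transverse.
  let s : (U ∩ (H : Set (EuclideanSpace ℝ (Fin n))) : Set _) → EuclideanSpace ℝ (Fin n) :=
    fun q => (L.fibre q).submodule.starProjection ν
  have hs : Continuous s := (continuous_starProjection_submodule ν).comp L.continuous_fibre
  have hsmem (q) : s q ∈ (L.fibre q).submodule := starProjection_apply_mem _ _
  have hsp : inner ℝ ν (s p) ≠ (0 : ℝ) := by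
    intro h0
    have h1 : s p = 0 := by
      rw [← inner_self_eq_zero (𝕜 := ℝ)]
      have h2 : inner ℝ (s p) (ν - s p) = (0 : ℝ) :=
        inner_right_of_mem_orthogonal (hsmem p) (sub_starProjection_mem_orthogonal ν)
      rw [inner_sub_right, real_inner_comm, h0] at h2
      linarith
    have h2 : ν ∈ (L.fibre p).submoduleᗮ := (starProjection_apply_eq_zero_iff _).1 h1
    refine hut ?_
    rw [SetLike.mem_coe, hdir, mem_orthogonal_singleton_iff_inner_right]
    exact inner_left_of_mem_orthogonal hu h2
  have hmem {d : (ℝ ∙ ν)ᗮ} (hd : (p : EuclideanSpace ℝ (Fin n)) + d ∈ U) :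
      (p : EuclideanSpace ℝ (Fin n)) + d ∈ U ∩ (H : Set (EuclideanSpace ℝ (Fin n))) := by
    refine ⟨hd, ?_⟩
    have := H.vadd_mem_of_mem_direction (v := (d : EuclideanSpace ℝ (Fin n)))
      (by rw [hdir]; exact d.2) p.2.2
    rwa [vadd_eq_add, add_comm] at this
  have hadd : Continuous fun d : (ℝ ∙ ν)ᗮ => (p : EuclideanSpace ℝ (Fin n)) + d :=
    continuous_const.add continuous_subtype_val
  let O : Set (ℝ ∙ ν)ᗮ := {d | (p : EuclideanSpace ℝ (Fin n)) + d ∈ U}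
  have hO : IsOpen O := hU.preimage hadd
  classical
  -- The value `0` off `O` is never used, since the ball chosen below lies in `O`.
  let σ : (ℝ ∙ ν)ᗮ → EuclideanSpace ℝ (Fin n) := fun d => if hd : d ∈ O then s ⟨_, hmem hd⟩ else 0
  have hσ : ContinuousOn σ O := by
    rw [continuousOn_iff_continuous_domRestrict]
    have : O.domRestrict σ = fun d => s ⟨_, hmem d.2⟩ := by
      funext d
      exact dif_pos d.2
    rw [this]
    exact hs.comp ((hadd.comp continuous_subtype_val).subtype_mk _)
  have h0O : (0 : (ℝ ∙ ν)ᗮ) ∈ O := by simpa [O] using p.2.1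
  have hσ0 : σ 0 = s p := by
    simp only [σ, dif_pos h0O]
    congr 1
    ext1
    simp
  have hnhds : O ∩ {d | inner ℝ ν (σ d) ≠ (0 : ℝ)} ∈ 𝓝 (0 : (ℝ ∙ ν)ᗮ) := by
    refine Filter.inter_mem (hO.mem_nhds h0O) ?_
    have hc : ContinuousAt (fun d => (inner ℝ ν (σ d) : ℝ)) 0 :=
      continuousAt_const.inner (hσ.continuousAt (hO.mem_nhds h0O))
    exact hc.eventually_ne (by rwa [hσ0])
  obtain ⟨r, hr, hball⟩ := nhds_basis_closedBall.mem_iff.1 hnhds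
  refine ⟨p, mem_interior_iff_mem_nhds.2 (mem_nhds_of_forall_add_smul_mem hν hr
    (v := fun d => (inner ℝ ν (σ d) : ℝ)⁻¹ • σ d) ?_ ?_ ?_)⟩
  · have h1 : ContinuousOn σ (closedBall 0 r) := hσ.mono fun d hd => (hball hd).1
    exact ((continuousOn_const.inner h1).inv₀ fun d hd => (hball hd).2).smul h1
  · intro d hd
    rw [inner_smul_right, inv_mul_cancel₀ (hball hd).2]
  · intro d hd t
    refine ⟨(_, t • ((inner ℝ ν (σ d) : ℝ)⁻¹ • σ d)), ⟨⟨_, hmem (hball hd).1⟩, rfl, ?_⟩, rfl⟩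
    refine smul_mem _ _ (smul_mem _ _ ?_)
    simp only [σ, dif_pos (hball hd).1]
    exact hsmem _

end LineBundles

theorem theorem5p8 {n : ℕ} (M : Set (EuclideanSpace ℝ (Fin n))) (hM : IsLinearHypersurface M)
    (L : EmbeddedLineBundle M) :
    (interior (codiagonalImage L.totalSpace)).Nonempty ↔ ¬ L.IsTangent := by
  obtain ⟨H, -, hH, U, hU, rfl⟩ := hM
  refine ⟨fun hne hL => ?_, interior_codiagonalImage_nonempty_of_not_isTangent hU hH⟩
  have htop : H ≠ ⊤ := by
    rintro rfl
    rw [AffineSubspace.direction_top, finrank_top, finrank_euclideanSpace_fin] at hH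
    omega
  exact hne.ne_empty (interior_codiagonalImage_eq_empty_of_isTangent hU htop hL)
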